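/- Let $\mathfrak H$ be a complex Hilbert space and $J$ a fundamental symmetry in $\mathfrak H$, i.e. a bounded operator with $J=J^*$, $J^2=I$. A bounded operator $C$ is said to realize a $C$-symmetry of an operator $A$ (with respect to $J$) if $C^2=I$, $JC>0$ (that is, $JC$ is self-adjoint and $(JCx,x)>0$ for $x\ne0$), and $AC=CA$. Let $S$ be a densely defined symmetric operator in $\mathfrak H$ with $SJ=JS$, and let $\{C_\alpha\}_{\alpha\in D}$ be the collection of all operators realizing a $C$-symmetry of $S$. Let $\Sigma_J^{\mathsf{st}}$ be the set of all $J$-self-adjoint extensions $A$ of $S$ (densely defined operators $A\supset S$ with $A^*J=JA$) that have a $C$-symmetry realized by some $C\in\{C_\alpha\}_{\alpha\in D}$. Let $(\mathcal H,\Gamma_0,\Gamma_1)$ be a boundary triplet of $S^*$: $\mathcal H$ is a complex Hilbert space, $\Gamma_0,\Gamma_1:\mathcal D(S^*)\to\mathcal H$ are linear, $(\Gamma_0,\Gamma_1):\mathcal D(S^*)\to\mathcal H\oplus\mathcal H$ is surjective, and $(S^*x,y)-(x,S^*y)=(\Gamma_1x,\Gamma_0y)-(\Gamma_0x,\Gamma_1y)$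 for all $x,y\in\mathcal D(S^*)$. Assume that every $C_\alpha$ has a boundary image, i.e. that there is a bounded operator $\mathcal C_\alpha$ in $\mathcal H$ with $\mathcal C_\alpha\Gamma_jf=\Gamma_jC_\alpha f$ for all $f\in\mathcal D(S^*)$, $j=0,1$; let $\mathcal J$ be the boundary image of $J$. Put $\Omega_\pm=\frac1{\sqrt2}(\Gamma_1\pm i\Gamma_0)$ and, for a bounded operator $\mathcal K$ in $\mathcal H$, $$A_{\mathcal K}=S^*\upharpoonright\{f\in\mathcal D(S^*)\mid \mathcal K\Omega_+f=\Omega_-f\}.$$ An operator $\mathcal K$ is called $\mathcal J$-unitary if it is bounded, maps $\mathcal H$ onto $\mathcal H$, and satisfies $(\mathcal J\mathcal Kx,\mathcal Ky)=(\mathcal Jx,y)$ for all $x,y\in\mathcal H$. Then every $A\in\Sigma_J^{\mathsf{st}}$ is of the form $A_{\mathcal K}$ with some bounded $\mathcal K$, and for every bounded operator $\mathcal K$ in $\mathcal H$ the following are equivalent: (a) $A_{\mathcal K}\in\Sigma_J^{\mathsf{st}}$; (b) $\mathcal K$ is $\mathcal J$-unitary and some $\mathcal C\in\{\mathcal C_\alpha\}_{\alpha\in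 D}$ realizes a $C$-symmetry of $\mathcal K$ with respect to $\mathcal J$, i.e. $\mathcal C^2=I$, $\mathcal J\mathcal C>0$, $\mathcal K\mathcal C=\mathcal C\mathcal K$; (c) $\mathcal K$ is $\mathcal J$-unitary and commutes with some $\mathcal C\in\{\mathcal C_\alpha\}_{\alpha\in D}$. -/

import Mathlib

open scoped InnerProductSpace LinearPMap

noncomputable section

namespace KreinExt

variable {H : Type*} [NormedAddCommGroup H] [InnerProductSpace ℂ H]
variable {E : Type*} [NormedAddCommGroup E] [InnerProductSpace ℂ E]

/-- Equality `B T = T A` of products of the (unbounded) operators `A`, `B` with the bounded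
operator `T`: the domains `{x | T x ∈ D(B)}` and `D(A)` coincide, and so do the values. -/
def Intertwines (B A : H →ₗ.[ℂ] H) (T : H →L[ℂ] H) : Prop :=
  (∀ x : H, T x ∈ B.domain ↔ x ∈ A.domain) ∧
    ∀ (x : A.domain) (hx : T x ∈ B.domain), B ⟨T x, hx⟩ = T (A x)

/-- `[A, T] = 0`, i.e. `A T = T A`. -/
def CommutesWith (A : H →ₗ.[ℂ] H) (T : H →L[ℂ] H) : Prop := Intertwines A A T

/-- `A` is a densely defined symmetric operator. -/
def IsSymmetricOp (A : H →ₗ.[ℂ] H) : Prop :=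
  Dense (A.domain : Set H) ∧ ∀ x y : A.domain, ⟪A x, (y : H)⟫_ℂ = ⟪(x : H), A y⟫_ℂ

section Complete

variable [CompleteSpace H] [CompleteSpace E]

/-- A fundamental symmetry: `J = J*` and `J² = I` (the trivial cases `J = ± I` are allowed). -/
def IsFundamentalSymmetry (J : H →L[ℂ] H) : Prop :=
  IsSelfAdjoint J ∧ J ∘L J = ContinuousLinearMap.id ℂ H

/-- `T > 0`: `T` is self-adjoint and `(T x, x) > 0` for every `x ≠ 0`. -/
def IsStrictlyPos (T : H →L[ℂ] H) : Prop :=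
  IsSelfAdjoint T ∧ ∀ x : H, x ≠ 0 → 0 < (⟪x, T x⟫_ℂ).re

/-- The operator `A` has the `C`-symmetry with respect to `[x, y]_J = (J x, y)`:
`C² = I`, `J C > 0` and `A C = C A`. -/
structure HasCSymmetry (J : H →L[ℂ] H) (A : H →ₗ.[ℂ] H) (C : H →L[ℂ] H) : Prop where
  sq : C ∘L C = ContinuousLinearMap.id ℂ H
  pos : IsStrictlyPos (J ∘L C)
  comm : CommutesWith A C

/-- `A` is densely defined and `J`-self-adjoint: `A* J = J A`. -/
def IsJSelfAdjoint (J : H →L[ℂ] H) (A : H →ₗ.[ℂ] H) : Prop :=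
  Dense (A.domain : Set H) ∧ Intertwines A† A J

/-- The set `Σ_J` of all `J`-self-adjoint extensions of `S`. -/
def SigmaJ (J : H →L[ℂ] H) (S : H →ₗ.[ℂ] H) : Set (H →ₗ.[ℂ] H) :=
  {A | S ≤ A ∧ IsJSelfAdjoint J A}

/-- The set `Σ_J^st` of `J`-self-adjoint extensions of `S` with stable `C`-symmetry:
one and the same `C` realizes a `C`-symmetry of `A` and of `S`. -/
def SigmaJst (J : H →L[ℂ] H) (S : H →ₗ.[ℂ] H) : Set (H →ₗ.[ℂ] H) :=
  {A | A ∈ SigmaJ J S ∧ ∃ C : H →L[ℂ] H, HasCSymmetry J S C ∧ HasCSymmetry J A C}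

/-- `K` is `J`-unitary: bounded, onto, and `[K x, K y]_J = [x, y]_J`.
(The scalar product `(x, y)`, linear in `x`, is `⟪y, x⟫_ℂ`.) -/
def IsJUnitary (J K : E →L[ℂ] E) : Prop :=
  Function.Surjective K ∧ ∀ x y : E, ⟪K y, J (K x)⟫_ℂ = ⟪y, J x⟫_ℂ

/-- A bounded operator as an operator with domain the whole space. -/
def ofBounded (K : E →L[ℂ] E) : E →ₗ.[ℂ] E := (K : E →ₗ[ℂ] E).toPMap ⊤

variable (E) in
/-- A boundary triplet `(E, Γ₀, Γ₁)` of `S*`. -/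
structure BoundaryTriplet (S : H →ₗ.[ℂ] H) where
  /-- the boundary map `Γ₀` -/
  Γ₀ : S†.domain →ₗ[ℂ] E
  /-- the boundary map `Γ₁` -/
  Γ₁ : S†.domain →ₗ[ℂ] E
  /-- `(S* x, y) - (x, S* y) = (Γ₁ x, Γ₀ y) - (Γ₀ x, Γ₁ y)` -/
  green : ∀ x y : S†.domain,
    ⟪(y : H), S† x⟫_ℂ - ⟪S† y, (x : H)⟫_ℂ = ⟪Γ₀ y, Γ₁ x⟫_ℂ - ⟪Γ₁ y, Γ₀ x⟫_ℂ
  surjective : Function.Surjective fun x : S†.domain => (Γ₀ x, Γ₁ x)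

namespace BoundaryTriplet

variable {S : H →ₗ.[ℂ] H} (B : BoundaryTriplet E S)

/-- `Ω₊ = (Γ₁ + i Γ₀) / √2` -/
def Ωplus : S†.domain →ₗ[ℂ] E := ((1 / Real.sqrt 2 : ℝ) : ℂ) • (B.Γ₁ + Complex.I • B.Γ₀)

/-- `Ω₋ = (Γ₁ - i Γ₀) / √2` -/
def Ωminus : S†.domain →ₗ[ℂ] E := ((1 / Real.sqrt 2 : ℝ) : ℂ) • (B.Γ₁ - Complex.I • B.Γ₀)

/-- The restriction of `S*` to `{f ∈ D(S*) | K Ω₊ f = Ω₋ f}`. -/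
def extension (K : E →L[ℂ] E) : H →ₗ.[ℂ] H :=
  S†.domRestrict
    ((LinearMap.ker ((K : E →ₗ[ℂ] E) ∘ₗ B.Ωplus - B.Ωminus)).map S†.domain.subtype)

/-- `𝒞` is the boundary image of `C`: `𝒞 Γ₀ f = Γ₀ C f` and `𝒞 Γ₁ f = Γ₁ C f` for all
`f ∈ D(S*)`. That `C f ∈ D(S*)` is automatic for the operators `C` of interest, see
`mem_adjoint_domain`. -/
def IsImage (C : H →L[ℂ] H) (𝒞 : E →L[ℂ] E) : Prop :=
  ∀ f : S†.domain, ∃ h : C f ∈ S†.domain,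
    𝒞 (B.Γ₀ f) = B.Γ₀ ⟨C f, h⟩ ∧ 𝒞 (B.Γ₁ f) = B.Γ₁ ⟨C f, h⟩

/-- Every `C` realizing a `C`-symmetry of `S` has a boundary image. -/
def HasImages (J : H →L[ℂ] H) : Prop :=
  ∀ C : H →L[ℂ] H, HasCSymmetry J S C → ∃ 𝒞 : E →L[ℂ] E, B.IsImage C 𝒞

/-- The set of the boundary images of all operators `C` realizing a `C`-symmetry of `S`. -/
def images (J : H →L[ℂ] H) : Set (E →L[ℂ] E) :=
  {𝒞 | ∃ C : H →L[ℂ] H, HasCSymmetry J S C ∧ B.IsImage C 𝒞}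

end BoundaryTriplet

/-- An operator `C` realizing a `C`-symmetry of `S` maps `D(S*)` into itself. -/
theorem mem_adjoint_domain {J : H →L[ℂ] H} {S : H →ₗ.[ℂ] H} (hd : Dense (S.domain : Set H))
    (hJ : IsFundamentalSymmetry J) (hSJ : CommutesWith S J) {C : H →L[ℂ] H}
    (hC : HasCSymmetry J S C) (f : S†.domain) : C f ∈ S†.domain := by
  have hJJ : ∀ x, J (J x) = x := fun x => by simpa using congrArg (fun T => T x) hJ.2
  have hJs : ∀ x y : H, ⟪J x, y⟫_ℂ = ⟪x, J y⟫_ℂ :=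
    fun x y => (ContinuousLinearMap.isSelfAdjoint_iff_isSymmetric.mp hJ.1) x y
  have hJC : ∀ x y : H, ⟪J (C x), y⟫_ℂ = ⟪x, J (C y)⟫_ℂ :=
    fun x y => (ContinuousLinearMap.isSelfAdjoint_iff_isSymmetric.mp hC.pos.1) x y
  have hadj : ∀ x y : H, ⟪C x, y⟫_ℂ = ⟪x, J (C (J y))⟫_ℂ := fun x y => by
    rw [← hJC, hJs, hJJ]
  refine LinearPMap.mem_adjoint_domain_of_exists _ ⟨C (S† f), fun y => ?_⟩
  have h1 : J (y : H) ∈ S.domain := (hSJ.1 _).2 y.2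
  have h2 : C (J (y : H)) ∈ S.domain := (hC.comm.1 _).2 h1
  have h3 : J (C (J (y : H))) ∈ S.domain := (hSJ.1 _).2 h2
  have e : S ⟨_, h3⟩ = J (C (J (S y))) := by
    rw [hSJ.2 ⟨_, h2⟩ h3, hC.comm.2 ⟨_, h1⟩ h2, hSJ.2 y h1]
  rw [hadj, hadj, ← e]
  exact S.adjoint_isFormalAdjoint hd f ⟨_, h3⟩

end Complete

end KreinExt

end

/-!
With `Ω = (Ω₊, Ω₋) : D(S*) → E × E`, which is onto, Green's identity reads
`(S* x, y) - (x, S* y) = i ((Ω₊ x, Ω₊ y) - (Ω₋ x, Ω₋ y))`. Hence `A* J = J A` for an extension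
`S ⊆ A ⊆ S*` says exactly that `M = Ω D(A)` is its own orthogonal companion for the form
`(𝒥 u, u') - (𝒥 v, v')` on `E × E` (`intertwines_adjoint_iff`). If `M` is the graph of a bounded
`K`, this means that `K` is `𝒥`-unitary (`extension_mem_SigmaJ_iff`), and `A_K` commutes with `C`
iff `K` commutes with the boundary image `𝒞` of `C` (`extension_commutesWith_iff`). This gives the
equivalence of (a) and (c).

For (b), and for the representation of every `A` with stable `C`-symmetry as some `A_K`, positivity
of `J C` has to pass to the boundary image `𝒥 𝒞` (`IsImage.isStrictlyPositive`). Self-adjointness of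
`𝒥 𝒞` follows from Green's identity. For `μ > 0` the operator `J C + μ` is coercive on the graph of
`S*`, so it maps `D(S*)` *onto* itself, and therefore `𝒥 𝒞 + μ` is onto; for `μ = 0` this is clear
from `J² = C² = I`. So the spectrum of the self-adjoint operator `𝒥 𝒞` lies in `(0, ∞)`. No
continuity of the boundary maps is needed.

Finally, if `M` is moreover invariant under `𝒞 ⊕ 𝒞`, then `(𝒥 𝒞 u, u) = (𝒥 𝒞 v, v)` for
`(u, v) ∈ M`, and since `(𝒥 𝒞 ·, ·)` is an equivalent scalar product, `M` is the graph of an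
isometry with closed domain; maximality of `M` makes the domain all of `E` (`exists_eq_graph`).
-/

namespace KreinExt

/-! ### Unbounded operators commuting with bounded ones -/

section Bounded

variable {H : Type*} [NormedAddCommGroup H] [InnerProductSpace ℂ H]
variable {E : Type*} [NormedAddCommGroup E] [InnerProductSpace ℂ E]

/-- `A T ⊇ T A`: the bounded operator `T` maps the domain of `A` into itself and commutes
with `A` there. -/
def Preserves (A : H →ₗ.[ℂ] H) (T : H →L[ℂ] H) : Prop :=
  ∀ x : A.domain, ∃ h : T x ∈ A.domain, A ⟨T x, h⟩ = T (A x)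

theorem Preserves.comp {A : H →ₗ.[ℂ] H} {T U : H →L[ℂ] H} (hT : Preserves A T)
    (hU : Preserves A U) : Preserves A (T ∘L U) := fun x => by
  obtain ⟨h, e⟩ := hU x
  obtain ⟨h', e'⟩ := hT ⟨U x, h⟩
  exact ⟨h', by simpa [e] using e'⟩

theorem CommutesWith.preserves {A : H →ₗ.[ℂ] H} {T : H →L[ℂ] H} (h : CommutesWith A T) :
    Preserves A T := fun x => ⟨(h.1 x).2 x.2, h.2 x _⟩

theorem Preserves.commutesWith {A : H →ₗ.[ℂ] H} {T : H →L[ℂ] H} (h : Preserves A T)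
    (hT : ∀ x, T (T x) = x) : CommutesWith A T := by
  refine ⟨fun x => ⟨fun hx => ?_, fun hx => (h ⟨x, hx⟩).1⟩, fun x _ => (h x).2⟩
  simpa [hT] using (h ⟨T x, hx⟩).1

section Complete

variable [CompleteSpace H] [CompleteSpace E]

/-- If `T*` commutes with `S` on `D(S)`, then `T` commutes with `S*` on `D(S*)`; here `U`
stands for `T*`. -/
theorem Preserves.adjoint {S : H →ₗ.[ℂ] H} (hd : Dense (S.domain : Set H)) {T U : H →L[ℂ] H}
    (hTU : ∀ x y, ⟪T x, y⟫_ℂ = ⟪x, U y⟫_ℂ) (hU : Preserves S U) : Preserves S† T := fun f => by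
  have key : ∀ y : S.domain, ⟪T (S† f), (y : H)⟫_ℂ = ⟪T f, S y⟫_ℂ := fun y => by
    obtain ⟨h, e⟩ := hU y
    rw [hTU, hTU, ← e]
    exact S.adjoint_isFormalAdjoint hd f ⟨_, h⟩
  exact ⟨LinearPMap.mem_adjoint_domain_of_exists _ ⟨_, key⟩,
    LinearPMap.adjoint_apply_eq hd _ key⟩

/-- A positive bounded operator `T` with `A T ⊇ T A`, `A` closed, is such that `T + μ` maps the
domain of `A` *onto* itself for every `μ > 0`: on the graph of `A`, a Hilbert space,
`T ⊕ T + μ` is coercive. -/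
theorem Preserves.exists_add_smul_eq {A : H →ₗ.[ℂ] H} (hA : A.IsClosed) {T : H →L[ℂ] H}
    (hT : Preserves A T) (hpos : ∀ x, 0 ≤ (⟪T x, x⟫_ℂ).re) {μ : ℝ} (hμ : 0 < μ) (f : A.domain) :
    ∃ g : A.domain, T g + (μ : ℂ) • (g : H) = f := by
  let e := WithLp.prodContinuousLinearEquiv 2 ℂ H H
  let M : Submodule ℂ (WithLp 2 (H × H)) := A.graph.comap (e : WithLp 2 (H × H) →ₗ[ℂ] H × H)
  have hM : IsClosed (M : Set (WithLp 2 (H × H))) := IsClosed.preimage e.continuous hA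
  have : CompleteSpace M := hM.completeSpace_coe
  let V : H →L[ℂ] H := T + (μ : ℂ) • ContinuousLinearMap.id ℂ H
  let W : WithLp 2 (H × H) →L[ℂ] WithLp 2 (H × H) :=
    (e.symm : H × H →L[ℂ] _) ∘L (V.prodMap V) ∘L (e : _ →L[ℂ] H × H)
  have hW : ∀ p ∈ M, W p ∈ M := fun p hp => by
    obtain ⟨y, h1, h2⟩ := (LinearPMap.mem_graph_iff A).1 hp
    obtain ⟨h, e1⟩ := hT y
    refine (LinearPMap.mem_graph_iff A).2 ⟨⟨T y, h⟩ + (μ : ℂ) • y, ?_, ?_⟩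
    · change T y + (μ : ℂ) • (y : H) = T (e p).1 + (μ : ℂ) • (e p).1
      rw [h1]; rfl
    · change _ = T (e p).2 + (μ : ℂ) • (e p).2
      rw [LinearPMap.map_add, LinearPMap.map_smul, e1, h2]; rfl
  let WM : M →L[ℂ] M := (W ∘L M.subtypeL).codRestrict M fun p => hW p p.2
  have hu : IsUnit WM := by
    refine ContinuousLinearMap.isUnit_of_forall_le_norm_inner_map WM (c := ⟨μ, hμ.le⟩) hμ
      fun p => ?_
    refine le_trans ?_ (Complex.re_le_norm _)
    have hin : ⟪WM p, p⟫_ℂ = ⟪V (e p).1, (e p).1⟫_ℂ + ⟪V (e p).2, (e p).2⟫_ℂ := rfl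
    have hn : ‖p‖ ^ 2 = ‖(e p).1‖ ^ 2 + ‖(e p).2‖ ^ 2 :=
      WithLp.prod_norm_sq_eq_of_L2 (p : WithLp 2 (H × H))
    have hV : ∀ x : H, μ * ‖x‖ ^ 2 ≤ (⟪V x, x⟫_ℂ).re := fun x => by
      have : ⟪V x, x⟫_ℂ = ⟪T x, x⟫_ℂ + ((μ * ‖x‖ ^ 2 : ℝ) : ℂ) := by
        simp [V, inner_self_eq_norm_sq_to_K]
      rw [this, Complex.add_re, Complex.ofReal_re]
      linarith [hpos x]
    rw [hin, hn, Complex.add_re]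
    change _ * μ ≤ _
    linarith [hV (e p).1, hV (e p).2]
  obtain ⟨p, hp⟩ := (ContinuousLinearMap.isUnit_iff_bijective.1 hu).2
    ⟨e.symm ((f : H), A f), A.mem_graph f⟩
  obtain ⟨y, h1, -⟩ := (LinearPMap.mem_graph_iff A).1 p.2
  refine ⟨y, ?_⟩
  have := congrArg (fun q : M => (e q).1) hp
  rw [h1]
  exact this

/-! ### Strict positivity of bounded operators -/

/-- A self-adjoint operator that maps onto the whole space is invertible. -/
theorem _root_.IsSelfAdjoint.isUnit_of_surjective {U : E →L[ℂ] E} (hU : IsSelfAdjoint U)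
    (hsurj : Function.Surjective U) : IsUnit U := by
  refine ContinuousLinearMap.isUnit_iff_bijective.2
    ⟨(injective_iff_map_eq_zero U).2 fun x hx => ?_, hsurj⟩
  obtain ⟨y, hy⟩ := hsurj x
  have := ContinuousLinearMap.isSelfAdjoint_iff_isSymmetric.mp hU x y
  simp only [ContinuousLinearMap.coe_coe] at this
  rw [hx, hy, inner_zero_left] at this
  exact inner_self_eq_zero.1 this.symm

/-- A self-adjoint operator `T` such that `T + μ` is onto for all `μ ≥ 0` has spectrum in
`(0, ∞)`. -/
theorem isStrictlyPositive_of_surjective {T : E →L[ℂ] E} (hT : IsSelfAdjoint T)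
    (h : ∀ μ : ℝ, 0 ≤ μ → ∀ y, ∃ x, T x + (μ : ℂ) • x = y) : IsStrictlyPositive T := by
  refine CStarAlgebra.isStrictlyPositive_iff_isSelfAdjoint_and_spectrum_pos.2
    ⟨hT, fun r hr => ?_⟩
  by_contra! hr0
  refine hr (IsSelfAdjoint.isUnit_of_surjective
    ((IsSelfAdjoint.algebraMap _ (IsSelfAdjoint.all r)).sub hT) fun y => ?_)
  obtain ⟨x, hx⟩ := h (-r) (by linarith) (-y)
  refine ⟨x, ?_⟩
  rw [← neg_neg y, ← hx]
  simp [Algebra.algebraMap_eq_smul_one, add_comm, sub_eq_add_neg]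

/-- Positive invertible operators are of the form `b* b` with `b` invertible. -/
theorem exists_unit_inner_eq {T : E →L[ℂ] E} (hT : IsStrictlyPositive T) :
    ∃ b : (E →L[ℂ] E)ˣ, ∀ u v, ⟪u, T v⟫_ℂ = ⟪(b : E →L[ℂ] E) u, (b : E →L[ℂ] E) v⟫_ℂ := by
  obtain ⟨c, hc, e⟩ := CStarAlgebra.isStrictlyPositive_iff_eq_star_mul_self.1 hT
  refine ⟨hc.unit, fun u v => ?_⟩
  rw [e]
  exact ContinuousLinearMap.adjoint_inner_right c u (c v)

/-! ### Self-orthogonal subspaces as graphs -/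

/-- A subspace of `E × E` that equals its own orthogonal companion for the form
`(𝒥 u, u') - (𝒥 v, v')` and is invariant under `𝒞 ⊕ 𝒞` is the graph of a bounded operator: by
invariance, `‖b u‖ = ‖b v‖` for its elements `(u, v)`, so the first projection is bounded below;
its range is dense, since any `w` orthogonal to it puts `(𝒥 w, 0)` into the subspace. -/
theorem exists_eq_graph {M : Submodule ℂ (E × E)} {𝒥 𝒞 : E →L[ℂ] E} (b : (E →L[ℂ] E)ˣ)
    (hb : ∀ u v, ⟪u, 𝒥 (𝒞 v)⟫_ℂ = ⟪(b : E →L[ℂ] E) u, (b : E →L[ℂ] E) v⟫_ℂ)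
    (h𝒥 : ∀ x, 𝒥 (𝒥 x) = x) 
    (hM : ∀ q : E × E, q ∈ M ↔ ∀ p ∈ M, ⟪p.1, 𝒥 q.1⟫_ℂ = ⟪p.2, 𝒥 q.2⟫_ℂ)
    (hinv : ∀ p ∈ M, (𝒞 p.1, 𝒞 p.2) ∈ M) : ∃ K : E →L[ℂ] E, ∀ q : E × E, q ∈ M ↔ K q.1 = q.2 := by
  let β : E →L[ℂ] E := b
  let β' : E →L[ℂ] E := ((b⁻¹ : (E →L[ℂ] E)ˣ) : E →L[ℂ] E)
  have hβ : ∀ x, β' (β x) = x := fun x =>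
    congrArg (fun T : E →L[ℂ] E => T x) b.inv_mul
  have hcl : IsClosed (M : Set (E × E)) := by
    have : (M : Set (E × E)) =
        ⋂ p ∈ M, {q : E × E | ⟪p.1, 𝒥 q.1⟫_ℂ = ⟪p.2, 𝒥 q.2⟫_ℂ} := by
      ext q; simpa using hM q
    rw [this]
    exact isClosed_biInter fun p _ => isClosed_eq (by fun_prop) (by fun_prop)
  have : CompleteSpace M := hcl.completeSpace_coe
  have hiso : ∀ p ∈ M, ‖β p.2‖ = ‖β p.1‖ := fun p hp => by
    have := (hM _).1 (hinv p hp) p hp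
    rw [hb, hb, inner_self_eq_norm_sq_to_K, inner_self_eq_norm_sq_to_K] at this
    have h2 : ‖β p.1‖ ^ 2 = ‖β p.2‖ ^ 2 := by exact_mod_cast this
    exact ((sq_eq_sq₀ (norm_nonneg _) (norm_nonneg _)).1 h2).symm
  let P : M →L[ℂ] E := ContinuousLinearMap.fst ℂ E E ∘L M.subtypeL
  have hanti : AntilipschitzWith (1 + ‖β'‖₊ * ‖β‖₊) P := by
    refine AddMonoidHomClass.antilipschitz_of_bound P fun p => ?_
    have h2 : ‖(p : E × E).2‖ ≤ ‖β'‖ * ‖β‖ * ‖(p : E × E).1‖ := by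
      calc ‖(p : E × E).2‖ = ‖β' (β (p : E × E).2)‖ := by rw [hβ]
        _ ≤ ‖β'‖ * ‖β (p : E × E).2‖ := β'.le_opNorm _
        _ = ‖β'‖ * ‖β (p : E × E).1‖ := by rw [hiso p p.2]
        _ ≤ ‖β'‖ * (‖β‖ * ‖(p : E × E).1‖) := by gcongr; exact β.le_opNorm _
        _ = _ := by ring
    have h3 : 0 ≤ ‖β'‖ * ‖β‖ * ‖(p : E × E).1‖ := by positivity
    have h4 := norm_nonneg (p : E × E).1
    have h5 : ‖P p‖ = ‖(p : E × E).1‖ := rfl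
    push_cast
    rw [h5, Submodule.coe_norm, Prod.norm_def]
    refine max_le ?_ ?_ <;> linarith
  have hclr : IsClosed (P.range : Set E) := by
    have := hanti.isClosed_range P.uniformContinuous
    rwa [← ContinuousLinearMap.coe_coe, ← LinearMap.coe_range] at this
  have hrange : P.range = ⊤ := by
    have : CompleteSpace P.range := hclr.completeSpace_coe
    rw [← Submodule.orthogonal_eq_bot_iff, Submodule.eq_bot_iff]
    intro w hw
    have hz : (𝒥 w, (0 : E)) ∈ M := (hM _).2 fun p hp => by
      simpa [h𝒥] using (Submodule.mem_orthogonal _ _).1 hw p.1 ⟨⟨p, hp⟩, rfl⟩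
    have h0 : β (𝒥 w) = 0 := by simpa using (hiso _ hz).symm
    have h1 : 𝒥 w = 0 := by rw [← hβ (𝒥 w), h0, map_zero]
    rw [← h𝒥 w, h1, map_zero]
  let F := ContinuousLinearEquiv.ofBijective P (LinearMap.ker_eq_bot.2 hanti.injective) hrange
  refine ⟨ContinuousLinearMap.snd ℂ E E ∘L M.subtypeL ∘L (F.symm : E →L[ℂ] M), fun q => ?_⟩
  have hF1 : ((F.symm q.1 : M) : E × E).1 = q.1 := F.apply_symm_apply q.1
  refine ⟨fun hq => ?_, fun hq => ?_⟩
  · have : F.symm q.1 = ⟨q, hq⟩ := F.symm_apply_apply ⟨q, hq⟩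
    simp [this]
  · have : ((F.symm q.1 : M) : E × E) = q := Prod.ext hF1 hq
    rw [← this]
    exact (F.symm q.1).2

end Complete

end Bounded

/-! ### Adjoints of operators with a `C`-symmetry -/

variable {H : Type*} [NormedAddCommGroup H] [InnerProductSpace ℂ H] [CompleteSpace H]
variable {E : Type*} [NormedAddCommGroup E] [InnerProductSpace ℂ E]

theorem IsFundamentalSymmetry.apply_apply {J : H →L[ℂ] H} (hJ : IsFundamentalSymmetry J) (x : H) :
    J (J x) = x := congrArg (fun T : H →L[ℂ] H => T x) hJ.2

theorem IsFundamentalSymmetry.inner_apply {J : H →L[ℂ] H} (hJ : IsFundamentalSymmetry J)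
    (x y : H) : ⟪J x, y⟫_ℂ = ⟪x, J y⟫_ℂ :=
  ContinuousLinearMap.isSelfAdjoint_iff_isSymmetric.mp hJ.1 x y

section CSymmetry

variable {J C : H →L[ℂ] H} {A S : H →ₗ.[ℂ] H}

theorem HasCSymmetry.apply_apply (hC : HasCSymmetry J A C) (x : H) : C (C x) = x :=
  congrArg (fun T : H →L[ℂ] H => T x) hC.sq

theorem HasCSymmetry.inner_apply (hC : HasCSymmetry J A C) (x y : H) :
    ⟪J (C x), y⟫_ℂ = ⟪x, J (C y)⟫_ℂ :=
  ContinuousLinearMap.isSelfAdjoint_iff_isSymmetric.mp hC.pos.1 x y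

theorem IsFundamentalSymmetry.preserves_adjoint (hJ : IsFundamentalSymmetry J)
    (hd : Dense (S.domain : Set H)) (hSJ : CommutesWith S J) : Preserves S† J :=
  hSJ.preserves.adjoint hd hJ.inner_apply

/-- `C* = J C J` commutes with `S`, so `C` commutes with `S*`. -/
theorem HasCSymmetry.preserves_adjoint (hC : HasCSymmetry J S C) (hJ : IsFundamentalSymmetry J)
    (hd : Dense (S.domain : Set H)) (hSJ : CommutesWith S J) : Preserves S† C :=
  (hSJ.preserves.comp (hC.comm.preserves.comp hSJ.preserves)).adjoint hd fun x y => by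
    change _ = ⟪x, J (C (J y))⟫_ℂ
    rw [← hC.inner_apply, hJ.inner_apply, hJ.apply_apply]

end CSymmetry

/-! ### Boundary maps and boundary images -/

namespace BoundaryTriplet

variable {S : H →ₗ.[ℂ] H} (B : BoundaryTriplet E S)

theorem Ωplus_apply (f : S†.domain) :
    B.Ωplus f = ((1 / Real.sqrt 2 : ℝ) : ℂ) • (B.Γ₁ f + Complex.I • B.Γ₀ f) := rfl

theorem Ωminus_apply (f : S†.domain) :
    B.Ωminus f = ((1 / Real.sqrt 2 : ℝ) : ℂ) • (B.Γ₁ f - Complex.I • B.Γ₀ f) := rfl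

theorem inv_sqrt_two_mul_self :
    ((1 / Real.sqrt 2 : ℝ) : ℂ) * ((1 / Real.sqrt 2 : ℝ) : ℂ) = 1 / 2 := by
  rw [← Complex.ofReal_mul, div_mul_div_comm, Real.mul_self_sqrt zero_le_two]
  norm_num

theorem exists_Ωplus_Ωminus (u v : E) : ∃ f : S†.domain, B.Ωplus f = u ∧ B.Ωminus f = v := by
  obtain ⟨f, hf⟩ := B.surjective
    ((-Complex.I * ((1 / Real.sqrt 2 : ℝ) : ℂ)) • (u - v), ((1 / Real.sqrt 2 : ℝ) : ℂ) • (u + v))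
  obtain ⟨h0, h1⟩ := Prod.mk.inj hf
  have hI : Complex.I * -Complex.I = 1 := by simp
  refine ⟨f, ?_⟩
  rw [Ωplus_apply, Ωminus_apply, h0, h1, ← mul_smul, ← mul_assoc, hI, one_mul, ← smul_add,
    ← smul_sub, ← mul_smul, ← mul_smul, inv_sqrt_two_mul_self]
  constructor <;> module

/-- Green's identity in terms of `Ω₊` and `Ω₋`. -/
theorem green_Ω (x y : S†.domain) :
    ⟪(y : H), S† x⟫_ℂ - ⟪S† y, (x : H)⟫_ℂ =
      Complex.I * (⟪B.Ωplus y, B.Ωplus x⟫_ℂ - ⟪B.Ωminus y, B.Ωminus x⟫_ℂ) := by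
  rw [B.green]
  simp only [Ωplus_apply, Ωminus_apply, inner_smul_left, inner_smul_right, inner_add_left,
    inner_add_right, inner_sub_left, inner_sub_right, Complex.conj_ofReal, Complex.conj_I]
  linear_combination (2 * (⟪B.Γ₀ y, B.Γ₁ x⟫_ℂ - ⟪B.Γ₁ y, B.Γ₀ x⟫_ℂ) * Complex.I ^ 2) *
    inv_sqrt_two_mul_self + (⟪B.Γ₀ y, B.Γ₁ x⟫_ℂ - ⟪B.Γ₁ y, B.Γ₀ x⟫_ℂ) * Complex.I_sq

variable {B}

section Image

variable {C D : H →L[ℂ] H} {𝒞 𝒟 𝒥 : E →L[ℂ] E}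

theorem IsImage.Ωplus_map (h : B.IsImage C 𝒞) (f : S†.domain) (hf : C f ∈ S†.domain) :
    B.Ωplus ⟨C f, hf⟩ = 𝒞 (B.Ωplus f) := by
  obtain ⟨_, h0, h1⟩ := h f
  simp [Ωplus_apply, h0, h1]

theorem IsImage.Ωminus_map (h : B.IsImage C 𝒞) (f : S†.domain) (hf : C f ∈ S†.domain) :
    B.Ωminus ⟨C f, hf⟩ = 𝒞 (B.Ωminus f) := by
  obtain ⟨_, h0, h1⟩ := h f
  simp [Ωminus_apply, h0, h1]

theorem IsImage.comp (h : B.IsImage C 𝒞) (h' : B.IsImage D 𝒟) :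
    B.IsImage (C ∘L D) (𝒞 ∘L 𝒟) := fun f => by
  obtain ⟨m', h0', h1'⟩ := h' f
  obtain ⟨m, h0, h1⟩ := h ⟨D f, m'⟩
  exact ⟨m, by simpa [h0'] using h0, by simpa [h1'] using h1⟩

theorem IsImage.apply_apply (h : B.IsImage C 𝒞) (hC : ∀ x, C (C x) = x) (u : E) :
    𝒞 (𝒞 u) = u := by
  obtain ⟨f, rfl, -⟩ := B.exists_Ωplus_Ωminus u 0
  obtain ⟨m, -⟩ := h f
  obtain ⟨m', -⟩ := h ⟨C f, m⟩
  rw [← h.Ωplus_map f m, ← h.Ωplus_map _ m']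
  simp [hC]

/-- The boundary image of a symmetric operator commuting with `S*` is symmetric, by Green's
identity. -/
theorem IsImage.inner_apply (h : B.IsImage C 𝒞) (hC : ∀ x y, ⟪C x, y⟫_ℂ = ⟪x, C y⟫_ℂ)
    (hSC : Preserves S† C) (u v : E) : ⟪𝒞 u, v⟫_ℂ = ⟪u, 𝒞 v⟫_ℂ := by
  obtain ⟨f, rfl, hf⟩ := B.exists_Ωplus_Ωminus u 0
  obtain ⟨g, rfl, hg⟩ := B.exists_Ωplus_Ωminus v 0
  obtain ⟨mf, ef⟩ := hSC f
  obtain ⟨mg, eg⟩ := hSC g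
  have h1 := B.green_Ω g ⟨C f, mf⟩
  have h2 := B.green_Ω ⟨C g, mg⟩ f
  rw [ef, hC, hC, h.Ωplus_map, hg, inner_zero_right, sub_zero] at h1
  rw [eg, h.Ωplus_map, hf, inner_zero_left, sub_zero] at h2
  exact mul_left_cancel₀ Complex.I_ne_zero (h1.symm.trans h2)

variable [CompleteSpace E]

/-- The boundary image of the positive operator `J C` is positive and invertible. Positivity
passes to the boundary because `J C + μ`, `μ ≥ 0`, maps `D(S*)` onto itself. -/
theorem IsImage.isStrictlyPositive {J : H →L[ℂ] H} (h𝒥 : B.IsImage J 𝒥) (h : B.IsImage C 𝒞)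
    (hJ : IsFundamentalSymmetry J) (hd : Dense (S.domain : Set H)) (hSJ : CommutesWith S J)
    (hC : HasCSymmetry J S C) : IsStrictlyPositive (𝒥 ∘L 𝒞) := by
  have hG : B.IsImage (J ∘L C) (𝒥 ∘L 𝒞) := h𝒥.comp h
  have hSG : Preserves S† (J ∘L C) :=
    (hJ.preserves_adjoint hd hSJ).comp (hC.preserves_adjoint hJ hd hSJ)
  have hsa : IsSelfAdjoint (𝒥 ∘L 𝒞) := ContinuousLinearMap.isSelfAdjoint_iff_isSymmetric.2
    fun u v => hG.inner_apply hC.inner_apply hSG u v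
  refine isStrictlyPositive_of_surjective hsa fun μ hμ y => ?_
  rcases hμ.eq_or_lt with rfl | hμ
  · refine ⟨𝒞 (𝒥 y), ?_⟩
    simp [h.apply_apply hC.apply_apply, h𝒥.apply_apply hJ.apply_apply]
  · have hpos : ∀ x, 0 ≤ (⟪(J ∘L C) x, x⟫_ℂ).re := fun x => by
      rcases eq_or_ne x 0 with rfl | hx
      · simp
      · have : ⟪(J ∘L C) x, x⟫_ℂ = ⟪x, (J ∘L C) x⟫_ℂ := hC.inner_apply x x
        rw [this]
        exact (hC.pos.2 x hx).le
    obtain ⟨f, rfl, -⟩ := B.exists_Ωplus_Ωminus y 0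
    obtain ⟨g, hg⟩ := hSG.exists_add_smul_eq (LinearPMap.adjoint_isClosed hd) hpos hμ f
    obtain ⟨m, -⟩ := hSG g
    have : f = ⟨(J ∘L C) g, m⟩ + (μ : ℂ) • g := Subtype.ext hg.symm
    exact ⟨B.Ωplus g, by rw [this, map_add, map_smul, hG.Ωplus_map]⟩

theorem IsImage.isStrictlyPos {J : H →L[ℂ] H} (h𝒥 : B.IsImage J 𝒥) (h : B.IsImage C 𝒞)
    (hJ : IsFundamentalSymmetry J) (hd : Dense (S.domain : Set H)) (hSJ : CommutesWith S J)
    (hC : HasCSymmetry J S C) : IsStrictlyPos (𝒥 ∘L 𝒞) := by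
  have hs := h𝒥.isStrictlyPositive h hJ hd hSJ hC
  refine ⟨hs.isSelfAdjoint, fun x hx => ?_⟩
  obtain ⟨b, hb⟩ := exists_unit_inner_eq hs
  have hbx : (b : E →L[ℂ] E) x ≠ 0 := fun h0 => hx
    ((ContinuousLinearMap.isUnit_iff_bijective.1 b.isUnit).1 (by rw [h0, map_zero]))
  rw [hb, inner_self_eq_norm_sq_to_K]
  have : (0 : ℝ) < ‖(b : E →L[ℂ] E) x‖ ^ 2 := by positivity
  exact_mod_cast this

end Image

/-! ### Extensions of `S` and their boundary values -/

/-- The boundary form of `f` and `g` in terms of `Ω₊` and `Ω₋`. -/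
theorem inner_adjoint_eq_iff (B : BoundaryTriplet E S) (f g : S†.domain) :
    ⟪S† f, (g : H)⟫_ℂ = ⟪(f : H), S† g⟫_ℂ ↔
      ⟪B.Ωplus g, B.Ωplus f⟫_ℂ = ⟪B.Ωminus g, B.Ωminus f⟫_ℂ := by
  rw [← inner_conj_symm (S† f), ← inner_conj_symm (f : H), (starRingEnd ℂ).injective.eq_iff, ← sub_eq_zero,
    B.green_Ω f g, mul_eq_zero, or_iff_right Complex.I_ne_zero, sub_eq_zero]

/-- `f ∈ D(S*)` lies in `D(A*)`, `A ⊆ S*` an extension of `S`, iff its boundary form with every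
element of `D(A)` vanishes. -/
theorem mem_adjoint_domain_iff (B : BoundaryTriplet E S) (hd : Dense (S.domain : Set H))
    {A : H →ₗ.[ℂ] H} (hSA : S ≤ A) (hA : A ≤ S†) (f : S†.domain) :
    (f : H) ∈ A†.domain ↔ ∀ g : S†.domain, (g : H) ∈ A.domain →
      ⟪B.Ωplus g, B.Ωplus f⟫_ℂ = ⟪B.Ωminus g, B.Ωminus f⟫_ℂ := by
  have hdA : Dense (A.domain : Set H) := hd.mono hSA.1
  have hAS : ∀ (g : S†.domain) (hg : (g : H) ∈ A.domain), A ⟨g, hg⟩ = S† g :=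
    fun g hg => hA.2 rfl
  simp only [← B.inner_adjoint_eq_iff]
  refine ⟨fun hf g hg => ?_, fun hf => LinearPMap.mem_adjoint_domain_of_exists _ ⟨S† f, ?_⟩⟩
  · have e : S† f = A† ⟨f, hf⟩ := LinearPMap.adjoint_apply_eq hd f fun x => by
      rw [A.adjoint_isFormalAdjoint hdA ⟨f, hf⟩ ⟨x, hSA.1 x.2⟩, ← hSA.2 (x := x) rfl]
    rw [e, ← hAS g hg]
    exact A.adjoint_isFormalAdjoint hdA ⟨f, hf⟩ ⟨g, hg⟩
  · intro x
    rw [hf ⟨x, hA.1 x.2⟩ x.2, ← hAS _ x.2]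

/-- For extensions `A ⊆ S*` of `S` the identity `A* J = J A` is a condition on domains: `D(A)` is
its own orthogonal companion for the boundary form twisted by `𝒥`. -/
theorem intertwines_adjoint_iff (B : BoundaryTriplet E S) (hd : Dense (S.domain : Set H))
    {J : H →L[ℂ] H} (hJ : IsFundamentalSymmetry J) (hSJ : CommutesWith S J)
    {𝒥 : E →L[ℂ] E} (h𝒥 : B.IsImage J 𝒥) {A : H →ₗ.[ℂ] H} (hSA : S ≤ A) (hA : A ≤ S†) :
    Intertwines A† A J ↔ ∀ f : S†.domain, (f : H) ∈ A.domain ↔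
      ∀ g : S†.domain, (g : H) ∈ A.domain →
        ⟪B.Ωplus g, 𝒥 (B.Ωplus f)⟫_ℂ = ⟪B.Ωminus g, 𝒥 (B.Ωminus f)⟫_ℂ := by
  have hdA : Dense (A.domain : Set H) := hd.mono hSA.1
  have hSJ' := hJ.preserves_adjoint hd hSJ
  have hA' : A† ≤ S† := LinearPMap.IsFormalAdjoint.le_adjoint hd fun x y => by
    obtain ⟨x', hx', e⟩ := LinearPMap.exists_of_le hSA x
    rw [e, hx', (A.adjoint_isFormalAdjoint hdA).symm]
  have key : ∀ f : S†.domain, J f ∈ A†.domain ↔ ∀ g : S†.domain, (g : H) ∈ A.domain →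
      ⟪B.Ωplus g, 𝒥 (B.Ωplus f)⟫_ℂ = ⟪B.Ωminus g, 𝒥 (B.Ωminus f)⟫_ℂ := fun f => by
    obtain ⟨m, -⟩ := hSJ' f
    have := B.mem_adjoint_domain_iff hd hSA hA ⟨J f, m⟩
    simpa only [h𝒥.Ωplus_map, h𝒥.Ωminus_map] using this
  simp only [← key]
  refine ⟨fun h f => (h.1 f).symm, fun h => ⟨fun x => ⟨fun hx => ?_, fun hx => ?_⟩, ?_⟩⟩
  · have m : x ∈ S†.domain := by
      obtain ⟨m, -⟩ := hSJ' ⟨_, hA'.1 hx⟩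
      simpa [hJ.apply_apply] using m
    exact (h ⟨x, m⟩).2 hx
  · exact (h ⟨x, hA.1 hx⟩).1 hx
  · intro x hx
    obtain ⟨m, e⟩ := hSJ' ⟨x, hA.1 x.2⟩
    rw [hA'.2 (x := ⟨J x, hx⟩) (y := ⟨J x, m⟩) rfl, e, hA.2 (x := x) (y := ⟨x, hA.1 x.2⟩) rfl]

theorem le_adjoint_of_mem_SigmaJ {J : H →L[ℂ] H} (hd : Dense (S.domain : Set H))
    (hJ : IsFundamentalSymmetry J) (hSJ : CommutesWith S J) {A : H →ₗ.[ℂ] H}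
    (hA : A ∈ SigmaJ J S) : A ≤ S† := by
  obtain ⟨hSA, hdA, hdom, hval⟩ := hA
  refine LinearPMap.IsFormalAdjoint.le_adjoint hd fun x y => ?_
  -- `(S x, y) = (S J x, J y) = (A J x, J y) = (J x, A* J y) = (J x, J A y)`
  have hx : J x ∈ S.domain := (hSJ.1 x).2 x.2
  have hy : J y ∈ A†.domain := (hdom y).2 y.2
  have h1 := (A.adjoint_isFormalAdjoint hdA).symm ⟨J x, hSA.1 hx⟩ ⟨J y, hy⟩
  rw [hval y hy, ← hSA.2 (x := ⟨J x, hx⟩) rfl, hSJ.2 x hx] at h1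
  simpa only [hJ.inner_apply, hJ.apply_apply] using h1

/-! ### Extensions given by an operator between the boundary values -/

theorem mem_extension_domain_iff (K : E →L[ℂ] E) (f : S†.domain) :
    (f : H) ∈ (B.extension K).domain ↔ K (B.Ωplus f) = B.Ωminus f := by
  simp [extension, sub_eq_zero]

theorem extension_le (K : E →L[ℂ] E) : B.extension K ≤ S† := LinearPMap.domRestrict_le

/-- Green's identity forces the boundary values of elements of `D(S)` to vanish. -/
theorem le_extension (hS : IsSymmetricOp S) (K : E →L[ℂ] E) : S ≤ B.extension K := by
  have hle : S ≤ S† := LinearPMap.IsFormalAdjoint.le_adjoint hS.1 hS.2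
  have hdom : S.domain ≤ (B.extension K).domain := fun x hx => by
    let f : S†.domain := ⟨x, hle.1 hx⟩
    have hf : S† f = S ⟨x, hx⟩ := (hle.2 rfl).symm
    have hz : ∀ g, ⟪B.Ωplus g, B.Ωplus f⟫_ℂ = ⟪B.Ωminus g, B.Ωminus f⟫_ℂ := fun g => by
      rw [← B.inner_adjoint_eq_iff, hf]
      exact (S.adjoint_isFormalAdjoint hS.1).symm ⟨x, hx⟩ g
    have hp : B.Ωplus f = 0 := by
      obtain ⟨g, h1, h2⟩ := B.exists_Ωplus_Ωminus (B.Ωplus f) 0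
      simpa [h1, h2] using hz g
    have hm : B.Ωminus f = 0 := by
      obtain ⟨g, h1, h2⟩ := B.exists_Ωplus_Ωminus 0 (B.Ωminus f)
      have := hz g
      rw [h1, h2, inner_zero_left] at this
      exact inner_self_eq_zero.1 this.symm
    exact (B.mem_extension_domain_iff K f).2 (by rw [hp, hm, map_zero])
  exact ⟨hdom, fun x y hxy => (hle.2 (y := ⟨y, (B.extension_le K).1 y.2⟩) hxy).trans
    ((B.extension_le K).2 rfl).symm⟩

end BoundaryTriplet

/-! ### `J`-self-adjointness and `C`-symmetries of `A_K` -/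

theorem commutesWith_ofBounded [CompleteSpace E] {K 𝒞 : E →L[ℂ] E} :
    CommutesWith (ofBounded K) 𝒞 ↔ K ∘L 𝒞 = 𝒞 ∘L K := by
  refine ⟨fun h => ?_, fun h => ⟨fun x => iff_of_true trivial trivial, fun x _ => ?_⟩⟩
  · ext x
    exact h.2 ⟨x, trivial⟩ trivial
  · exact congrArg (fun T : E →L[ℂ] E => T x) h

namespace BoundaryTriplet

variable {S : H →ₗ.[ℂ] H} {B : BoundaryTriplet E S} {J C : H →L[ℂ] H} {𝒥 𝒞 : E →L[ℂ] E}

/-- `A_K` is `J`-self-adjoint iff the graph of `K` is its own orthogonal companion for the form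
`(𝒥 u, u') - (𝒥 v, v')`, i.e. iff `K` is `𝒥`-unitary. -/
theorem extension_mem_SigmaJ_iff [CompleteSpace E] (hJ : IsFundamentalSymmetry J)
    (hS : IsSymmetricOp S) (hSJ : CommutesWith S J) (h𝒥 : B.IsImage J 𝒥) (K : E →L[ℂ] E) :
    B.extension K ∈ SigmaJ J S ↔ IsJUnitary 𝒥 K := by
  have h𝒥𝒥 := h𝒥.apply_apply hJ.apply_apply
  have h𝒥s := h𝒥.inner_apply hJ.inner_apply (hJ.preserves_adjoint hS.1 hSJ)
  have hle := B.le_extension hS K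
  have hgraph : B.extension K ∈ SigmaJ J S ↔
      ∀ u v, K u = v ↔ ∀ w, ⟪w, 𝒥 u⟫_ℂ = ⟪K w, 𝒥 v⟫_ℂ := by
    have : B.extension K ∈ SigmaJ J S ↔ Intertwines (B.extension K)† (B.extension K) J :=
      ⟨fun h => h.2.2, fun h => ⟨hle, hS.1.mono hle.1, h⟩⟩
    rw [this, B.intertwines_adjoint_iff hS.1 hJ hSJ h𝒥 hle (B.extension_le K)]
    simp only [mem_extension_domain_iff]
    have hall : ∀ u v, (∀ g, K (B.Ωplus g) = B.Ωminus g →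
        ⟪B.Ωplus g, 𝒥 u⟫_ℂ = ⟪B.Ωminus g, 𝒥 v⟫_ℂ) ↔ ∀ w, ⟪w, 𝒥 u⟫_ℂ = ⟪K w, 𝒥 v⟫_ℂ := by
      refine fun u v => ⟨fun h w => ?_, fun h g hg => by rw [h, hg]⟩
      obtain ⟨g, h1, h2⟩ := B.exists_Ωplus_Ωminus w (K w)
      have := h g (by rw [h1, h2])
      rwa [h1, h2] at this
    simp only [hall]
    refine ⟨fun h u v => ?_, fun h f => h _ _⟩
    obtain ⟨f, rfl, rfl⟩ := B.exists_Ωplus_Ωminus u v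
    exact h f
  rw [hgraph]
  refine ⟨fun h => ⟨fun v => ?_, fun x y => ((h x (K x)).1 rfl y).symm⟩, fun h u v => ?_⟩
  · -- the preimage of `v` is `𝒥 K* 𝒥 v`, because `K* 𝒥 K = 𝒥`
    refine ⟨𝒥 (ContinuousLinearMap.adjoint K (𝒥 v)), (h _ v).2 fun w => ?_⟩
    rw [h𝒥𝒥, ContinuousLinearMap.adjoint_inner_right]
  · refine ⟨fun huv w => by rw [← huv, h.2], fun huv => ?_⟩
    have h0 : ∀ w, ⟪K w, 𝒥 v - 𝒥 (K u)⟫_ℂ = 0 := fun w => by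
      rw [inner_sub_right, h.2, huv, sub_self]
    obtain ⟨w, hw⟩ := h.1 (𝒥 v - 𝒥 (K u))
    have h1 := h0 w
    rw [hw, inner_self_eq_zero, sub_eq_zero] at h1
    rw [← h𝒥𝒥 v, h1, h𝒥𝒥]

/-- `A_K` commutes with `C` iff `K` commutes with the boundary image of `C`. -/
theorem extension_commutesWith_iff (h : B.IsImage C 𝒞) (hSC : Preserves S† C)
    (hC : ∀ x, C (C x) = x) (K : E →L[ℂ] E) :
    CommutesWith (B.extension K) C ↔ K ∘L 𝒞 = 𝒞 ∘L K := by
  refine ⟨fun hK => ?_, fun hK => Preserves.commutesWith (fun x => ?_) hC⟩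
  · ext u
    obtain ⟨f, rfl, hf⟩ := B.exists_Ωplus_Ωminus u (K u)
    obtain ⟨m, -⟩ := hSC f
    have h1 : C f ∈ (B.extension K).domain :=
      (hK.1 f).2 ((B.mem_extension_domain_iff K f).2 hf.symm)
    have h2 := (B.mem_extension_domain_iff K ⟨C f, m⟩).1 h1
    rw [h.Ωplus_map, h.Ωminus_map, hf] at h2
    exact h2
  · have hx := (B.extension_le K).1 x.2
    obtain ⟨m, e⟩ := hSC ⟨x, hx⟩
    have hmem : C x ∈ (B.extension K).domain := by
      refine (B.mem_extension_domain_iff K ⟨C x, m⟩).2 ?_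
      have h1 := (B.mem_extension_domain_iff K ⟨x, hx⟩).1 x.2
      rw [h.Ωplus_map ⟨x, hx⟩, h.Ωminus_map ⟨x, hx⟩, ← h1]
      exact congrArg (fun T : E →L[ℂ] E => T _) hK
    refine ⟨hmem, ?_⟩
    rw [(B.extension_le K).2 (x := ⟨C x, hmem⟩) (y := ⟨C x, m⟩) rfl,
      (B.extension_le K).2 (x := x) (y := ⟨x, hx⟩) rfl, e]

/-- The boundary values of `D(A)` form the graph of a bounded operator when `A` is a
`J`-self-adjoint extension of `S` and some `C` realizes a `C`-symmetry of both. -/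
theorem exists_eq_extension [CompleteSpace E] (hJ : IsFundamentalSymmetry J)
    (hS : IsSymmetricOp S) (hSJ : CommutesWith S J) (h𝒥 : B.IsImage J 𝒥) (h : B.IsImage C 𝒞)
    (hSC : HasCSymmetry J S C) {A : H →ₗ.[ℂ] H} (hA : A ∈ SigmaJ J S) (hAC : CommutesWith A C) :
    ∃ K : E →L[ℂ] E, A = B.extension K := by
  have hAS := le_adjoint_of_mem_SigmaJ hS.1 hJ hSJ hA
  have hdom := (B.intertwines_adjoint_iff hS.1 hJ hSJ h𝒥 hA.1 hAS).1 hA.2.2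
  let M : Submodule ℂ (E × E) :=
    (A.domain.comap S†.domain.subtype).map (B.Ωplus.prod B.Ωminus)
  have hperp : ∀ q : E × E, (∀ p ∈ M, ⟪p.1, 𝒥 q.1⟫_ℂ = ⟪p.2, 𝒥 q.2⟫_ℂ) ↔
      ∀ g : S†.domain, (g : H) ∈ A.domain →
        ⟪B.Ωplus g, 𝒥 q.1⟫_ℂ = ⟪B.Ωminus g, 𝒥 q.2⟫_ℂ := by
    refine fun q => ⟨fun hq g hg => hq _ ⟨g, hg, rfl⟩, ?_⟩
    rintro hq _ ⟨g, hg, rfl⟩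
    exact hq g hg
  have hmem : ∀ f : S†.domain, (B.Ωplus f, B.Ωminus f) ∈ M ↔ (f : H) ∈ A.domain := by
    refine fun f => ⟨?_, fun hf => ⟨f, hf, rfl⟩⟩
    rintro ⟨g, hg, e⟩
    obtain ⟨h1, h2⟩ := Prod.mk.inj e
    rw [hdom, ← h1, ← h2]
    exact (hdom g).1 hg
  obtain ⟨b, hb⟩ := exists_unit_inner_eq (h𝒥.isStrictlyPositive h hJ hS.1 hSJ hSC)
  obtain ⟨K, hK⟩ := exists_eq_graph (M := M) (𝒞 := 𝒞) b hb (h𝒥.apply_apply hJ.apply_apply)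
    (fun q => by
      obtain ⟨f, h1, h2⟩ := B.exists_Ωplus_Ωminus q.1 q.2
      have : q = (B.Ωplus f, B.Ωminus f) := by rw [h1, h2]
      rw [hperp, this, hmem]
      exact hdom f)
    (by
      rintro _ ⟨f, hf, rfl⟩
      obtain ⟨m, -⟩ := hSC.preserves_adjoint hJ hS.1 hSJ f
      have := (hmem ⟨C f, m⟩).2 ((hAC.1 f).2 hf)
      rwa [h.Ωplus_map, h.Ωminus_map] at this)
  have hdomK : A.domain = (B.extension K).domain := by
    ext x
    refine ⟨fun hx => ?_, fun hx => ?_⟩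
    · exact (B.mem_extension_domain_iff K ⟨x, hAS.1 hx⟩).2 ((hK _).1 ((hmem ⟨x, _⟩).2 hx))
    · have hx' := (B.extension_le K).1 hx
      exact (hmem ⟨x, hx'⟩).1 ((hK _).2 ((B.mem_extension_domain_iff K ⟨x, hx'⟩).1 hx))
  refine ⟨K, LinearPMap.eq_of_le_of_domain_eq ⟨hdomK.le, fun x y hxy => ?_⟩ hdomK⟩
  exact (hAS.2 (y := ⟨y, (B.extension_le K).1 y.2⟩) hxy).trans ((B.extension_le K).2 rfl).symm

end BoundaryTriplet

end KreinExt

theorem corollary3p10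
    {H : Type*} [NormedAddCommGroup H] [InnerProductSpace ℂ H] [CompleteSpace H]
    {E : Type*} [NormedAddCommGroup E] [InnerProductSpace ℂ E] [CompleteSpace E]
    (J : H →L[ℂ] H) (hJ : KreinExt.IsFundamentalSymmetry J)
    (S : H →ₗ.[ℂ] H) (hS : KreinExt.IsSymmetricOp S) (hSJ : KreinExt.CommutesWith S J)
    (B : KreinExt.BoundaryTriplet E S) (hB : B.HasImages J)
    (𝒥 : E →L[ℂ] E) (h𝒥 : B.IsImage J 𝒥) :
    (∀ K : E →L[ℂ] E,
      (B.extension K ∈ KreinExt.SigmaJst J S ↔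
        KreinExt.IsJUnitary 𝒥 K ∧
          ∃ 𝒞 ∈ B.images J, KreinExt.HasCSymmetry 𝒥 (KreinExt.ofBounded K) 𝒞) ∧
      (B.extension K ∈ KreinExt.SigmaJst J S ↔
        KreinExt.IsJUnitary 𝒥 K ∧ ∃ 𝒞 ∈ B.images J, K ∘L 𝒞 = 𝒞 ∘L K)) ∧
    ∀ A ∈ KreinExt.SigmaJst J S, ∃ K : E →L[ℂ] E, A = B.extension K := by
  refine ⟨fun K => ?_, ?_⟩
  · have hac : B.extension K ∈ KreinExt.SigmaJst J S ↔
        KreinExt.IsJUnitary 𝒥 K ∧ ∃ 𝒞 ∈ B.images J, K ∘L 𝒞 = 𝒞 ∘L K := by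
      refine and_congr (B.extension_mem_SigmaJ_iff hJ hS hSJ h𝒥 K) ⟨?_, ?_⟩
      · rintro ⟨C, hSC, hAC⟩
        obtain ⟨𝒞, h𝒞⟩ := hB C hSC
        exact ⟨𝒞, ⟨C, hSC, h𝒞⟩, (B.extension_commutesWith_iff h𝒞
          (hSC.preserves_adjoint hJ hS.1 hSJ) hSC.apply_apply K).1 hAC.comm⟩
      · rintro ⟨𝒞, ⟨C, hSC, h𝒞⟩, hK⟩
        exact ⟨C, hSC, hSC.sq, hSC.pos, (B.extension_commutesWith_iff h𝒞
          (hSC.preserves_adjoint hJ hS.1 hSJ) hSC.apply_apply K).2 hK⟩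
    refine ⟨hac.trans (and_congr_right fun _ => exists_congr fun 𝒞 => and_congr_right ?_), hac⟩
    rintro ⟨C, hSC, h𝒞⟩
    refine ⟨fun hK => ⟨?_, h𝒥.isStrictlyPos h𝒞 hJ hS.1 hSJ hSC,
      KreinExt.commutesWith_ofBounded.2 hK⟩, fun h => KreinExt.commutesWith_ofBounded.1 h.comm⟩
    ext u
    exact h𝒞.apply_apply hSC.apply_apply u
  · rintro A ⟨hA, C, hSC, hAC⟩
    obtain ⟨𝒞, h𝒞⟩ := hB C hSC
    exact KreinExt.BoundaryTriplet.exists_eq_extension hJ hS hSJ h𝒥 h𝒞 hSC hA hAC.comm
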